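/- Fix integers $b\ge 1$ and $n\ge 1$. For $1\le i\le b$ let $C_i$ be the juggling card whose induced permutation $\pi_{C_i}$ of the levels $\{1,\dots,b\}$ sends $1$ to $i$, sends $j$ to $j-1$ for $2\le j\le i$, and fixes $j$ for $i<j\le b$. For a sequence of cards $A=C_{i_1}C_{i_2}\cdots C_{i_n}$ let $\pi_A$ be the permutation of $\{1,\dots,b\}$ obtained by applying $\pi_{C_{i_1}}$ first, then $\pi_{C_{i_2}}$, and so on up to $\pi_{C_{i_n}}$; that is, a ball that starts on level $i$ on the left of $A$ ends on level $\pi_A(i)$ on the right. Theorem. If $A$ is chosen uniformly at random among the $b^n$ sequences of $n$ cards from $\{C_1,\dots,C_b\}$ (the cards are drawn at random with replacement), then the probability that $\pi_A$ consists of a single cycle, i.e. is a $b$-cycle on $\{1,\dots,b\}$ (the identity counting as a $1$-cycle when $b=1$), is exactly $1/b$. In particular, this probability does not depend on $n\ge 1$. -/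

import Mathlib

/-- The permutation of the `b` levels induced by a one-ball juggling card. Levels and cards are
numbered from `0`, so `i : Fin b` stands for the card `C_{i+1}`: the bottom level `0` goes to
level `i`, level `j` goes to level `j - 1` for `0 < j ≤ i`, and levels above `i` are fixed.
(`Fin.cycleRange i` is the cycle `(0 1 … i)`, so its inverse is `(i … 1 0)`.) -/
def cardPerm {b : ℕ} (i : Fin b) : Equiv.Perm (Fin b) :=
  (Fin.cycleRange i).symm

/-- The three track rules that describe a card. -/
theorem cardPerm_apply_val {b : ℕ} (i j : Fin b) :
    (cardPerm i j : ℕ) =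
      if (j : ℕ) = 0 then (i : ℕ) else if (j : ℕ) ≤ i then (j : ℕ) - 1 else (j : ℕ) := by
  obtain ⟨k, rfl⟩ := (Fin.cycleRange i).surjective j
  rw [cardPerm, Equiv.symm_apply_apply]
  rcases lt_trichotomy k i with h | h | h
  · have h1 := Fin.coe_cycleRange_of_lt h
    rw [Fin.lt_def] at h
    rw [h1, if_neg (by omega), if_pos (by omega)]
    omega
  · subst h
    have : NeZero b := ⟨by have := k.2; omega⟩
    rw [Fin.cycleRange_self]
    simp
  · rw [Fin.cycleRange_of_gt h]
    rw [Fin.lt_def] at h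
    rw [if_neg (by omega), if_neg (by omega)]

/-- The permutation `π_A` of a sequence `A` of `n` cards laid out from left to right: a ball that
starts on level `i` on the left ends on level `cardSeqPerm A i` on the right. The ball passes
the cards `A 0, A 1, …, A (n - 1)` in this order, and the product of `Equiv.Perm` applies its
right-hand factor first, hence the reversal. -/
def cardSeqPerm {b n : ℕ} (A : Fin n → Fin b) : Equiv.Perm (Fin b) :=
  (List.ofFn fun t => cardPerm (A t)).reverse.prod

/-! Let T be the operator (T F)(σ) = Σ_i F(σ * `cardPerm i`). Summing F over the permutations of all
n-card sequences gives (T^n F)(1). Let S_j(F) be the sum of F over the permutations increasing on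
the positions from j on (`tailSum`). Then S_0(F) = F(1), S_j(T F) = j S_j(F) + S_{j+1}(F) for j < b,
and S_b(T F) = b S_b(F). So if S_1, …, S_b vanish on F, they vanish on T F, and (T F)(1) = 0 ·
S_0(F) + S_1(F) = 0; hence (T^n F)(1) = 0 for every n ≥ 1.

This is applied to b times the cycle indicator minus 1. It remains to see that among the
permutations counted by S_j, j ≥ 1, exactly one in b is a b-cycle: the totals come from the
recursion with F = 1, the cyclic ones from deleting the point 0 from its cycle. -/

/-! ### Single cycles and insertion of a point. -/

/-- If a map `f` sends `σ`-steps into `τ`-cycles, it sends `σ`-cycles into `τ`-cycles. -/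
theorem sameCycle_map_of_step {α β : Type*} [Finite α] {σ : Equiv.Perm α}
    {τ : Equiv.Perm β} {f : α → β} (h : ∀ y, τ.SameCycle (f y) (f (σ y))) {y z : α}
    (hyz : σ.SameCycle y z) : τ.SameCycle (f y) (f z) := by
  obtain ⟨n, -, -, rfl⟩ := hyz.exists_pow_eq''
  clear hyz
  induction n with
  | zero => exact .refl _ _
  | succ n ih => rw [pow_succ', Equiv.Perm.mul_apply]; exact ih.trans (h _)

theorem isCycleOn_univ_iff_sameCycle {α : Type*} {σ : Equiv.Perm α} :
    σ.IsCycleOn Set.univ ↔ ∀ x y, σ.SameCycle x y := by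
  simp [Equiv.Perm.IsCycleOn, Set.bijOn_univ, σ.bijective]

/-- The permutation of `Fin (m + 1)` obtained from `e` by inserting `0` after `x` in its cycle. -/
def insertZero {m : ℕ} (e : Equiv.Perm (Fin m)) (x : Fin m) : Equiv.Perm (Fin (m + 1)) :=
  Equiv.Perm.decomposeFin.symm ((e x).succ, e)

theorem insertZero_zero {m : ℕ} (e : Equiv.Perm (Fin m)) (x : Fin m) :
    insertZero e x 0 = (e x).succ := by
  simp [insertZero]

theorem insertZero_succ {m : ℕ} (e : Equiv.Perm (Fin m)) (x k : Fin m) :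
    insertZero e x k.succ = if k = x then 0 else (e k).succ := by
  rw [insertZero, Equiv.Perm.decomposeFin_symm_apply_succ]
  split_ifs with h
  · simp [h]
  · rw [Equiv.swap_apply_of_ne_of_ne (Fin.succ_ne_zero _)]
    simpa using h

theorem insertZero_isCycleOn_univ_iff {m : ℕ} (e : Equiv.Perm (Fin m)) (x : Fin m) :
    (insertZero e x).IsCycleOn Set.univ ↔ e.IsCycleOn Set.univ := by
  rw [isCycleOn_univ_iff_sameCycle, isCycleOn_univ_iff_sameCycle]
  constructor
  · intro h y z
    -- Contract 0 onto its successor `e x`: each step then becomes a step of `e` or stands still.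
    have key := sameCycle_map_of_step (σ := insertZero e x) (τ := e)
      (f := Fin.cons (e x) id) ?_ (h y.succ z.succ)
    · simpa using key
    · intro y
      refine Fin.cases ?_ (fun k => ?_) y
      · simp [insertZero_zero, Equiv.Perm.SameCycle.refl]
      · rw [insertZero_succ]
        split_ifs with hk
        · simp [hk, Equiv.Perm.SameCycle.refl]
        · simp [Equiv.Perm.SameCycle.refl]
  · intro h
    have h0 : (insertZero e x).SameCycle 0 (e x).succ := by
      rw [← insertZero_zero]; exact Equiv.Perm.sameCycle_apply_right.2 (.refl _ _)
    have hs : ∀ y z : Fin m, (insertZero e x).SameCycle y.succ z.succ := by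
      intro y z
      refine sameCycle_map_of_step (σ := e) (f := Fin.succ) (fun k => ?_) (h y z)
      by_cases hk : k = x
      · subst hk
        refine Equiv.Perm.SameCycle.trans ?_ h0
        have : insertZero e k k.succ = 0 := by simp [insertZero_succ]
        rw [← this]
        exact Equiv.Perm.sameCycle_apply_right.2 (.refl _ _)
      · have : insertZero e x k.succ = (e k).succ := by simp [insertZero_succ, hk]
        rw [← this]
        exact Equiv.Perm.sameCycle_apply_right.2 (.refl _ _)
    intro y z
    have hz : ∀ z, (insertZero e x).SameCycle 0 z := by
      intro z
      refine Fin.cases (.refl _ _) (fun k => h0.trans (hs _ _)) z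
    exact (hz y).symm.trans (hz z)

/-! ### Permutations increasing on a tail of positions. -/

/-- The permutations that keep the levels `j, j + 1, …` in their order. -/
def TailMono {b : ℕ} (j : ℕ) (σ : Equiv.Perm (Fin b)) : Prop :=
  StrictMonoOn σ {k | j ≤ (k : ℕ)}

theorem tailMono_of_le {b j : ℕ} (h : b ≤ j + 1) (σ : Equiv.Perm (Fin b)) : TailMono j σ := by
  intro k hk l hl hkl
  have := l.2
  simp only [Set.mem_ofPred_eq, Fin.lt_def] at hk hl hkl
  omega

theorem tailMono_zero_iff {b : ℕ} {σ : Equiv.Perm (Fin b)} : TailMono 0 σ ↔ σ = 1 := by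
  constructor
  · intro h
    have hm : StrictMono σ := fun x y hxy => h (Nat.zero_le _) (Nat.zero_le _) hxy
    ext x
    have := congrArg (fun f : Fin b ≃o Fin b => f x)
      (Subsingleton.elim (StrictMono.orderIsoOfSurjective σ hm σ.surjective) (OrderIso.refl _))
    simpa using congrArg Fin.val this
  · rintro rfl
    exact fun x _ y _ hxy => hxy

theorem insertZero_tailMono_of_lt {m j : ℕ} {e : Equiv.Perm (Fin m)} {x : Fin m}
    (hx : (x : ℕ) < j) : TailMono (j + 1) (insertZero e x) ↔ TailMono j e := by
  have hne : ∀ k : Fin m, j ≤ (k : ℕ) → insertZero e x k.succ = (e k).succ := by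
    intro k hk
    rw [insertZero_succ, if_neg]
    rintro rfl; omega
  constructor
  · intro h k hk l hl hkl
    have := @h k.succ (by simpa using hk) l.succ (by simpa using hl) (by simpa using hkl)
    rw [hne k hk, hne l hl] at this
    simpa using this
  · intro h k hk l hl hkl
    induction k using Fin.cases with
    | zero => simp at hk
    | succ k =>
      induction l using Fin.cases with
      | zero => simp at hl
      | succ l =>
        have hk' : j ≤ (k : ℕ) := by simpa using hk
        have hl' : j ≤ (l : ℕ) := by simpa using hl
        rw [hne k hk', hne l hl']
        simpa using h hk' hl' (by simpa using hkl)

/-- Position x + 1 carries the smallest value 0, so if it lies in the tail it must be the tail's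
first position. -/
theorem insertZero_tailMono_of_le {m j : ℕ} {e : Equiv.Perm (Fin m)} {x : Fin m}
    (hx : j ≤ (x : ℕ)) :
    TailMono (j + 1) (insertZero e x) ↔ (x : ℕ) = j ∧ TailMono (j + 1) e := by
  constructor
  · intro h
    have hxj : (x : ℕ) = j := by
      by_contra hne
      have hj : j < m := by have := x.2; omega
      have := @h (Fin.succ ⟨j, hj⟩) (by simp) x.succ (by simpa using hx)
        (by simp [Fin.lt_def]; omega)
      rw [insertZero_succ e x x, if_pos rfl] at this
      exact absurd this (Fin.not_lt_zero _)
    refine ⟨hxj, fun k hk l hl hkl => ?_⟩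
    simp only [Set.mem_ofPred_eq] at hk hl
    have := @h k.succ (by simp; omega) l.succ (by simp; omega) (by simpa using hkl)
    rw [insertZero_succ, insertZero_succ, if_neg (by rintro rfl; omega),
      if_neg (by rintro rfl; omega)] at this
    simpa using this
  · rintro ⟨hxj, h⟩ k hk l hl hkl
    induction k using Fin.cases with
    | zero => simp at hk
    | succ k =>
      induction l using Fin.cases with
      | zero => simp at hl
      | succ l =>
        simp only [Set.mem_ofPred_eq, Fin.val_succ, Nat.add_le_add_iff_right,
          Fin.lt_def] at hk hl hkl
        rw [insertZero_succ, insertZero_succ, if_neg (c := l = x) (by rintro rfl; omega)]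
        split_ifs with hkx
        · exact Fin.succ_pos _
        · have : (k : ℕ) ≠ x := fun h => hkx (Fin.ext h)
          exact Fin.succ_lt_succ_iff.2 (h (by simp; omega) (by simp; omega) (Fin.lt_def.2 (by omega)))

theorem tailMono_mul_cycleRange_of_lt {b j : ℕ} {π : Equiv.Perm (Fin b)} {i : Fin b}
    (hi : (i : ℕ) < j) : TailMono j (π * Fin.cycleRange i) ↔ TailMono j π := by
  have h : ∀ k : Fin b, j ≤ (k : ℕ) → (π * Fin.cycleRange i) k = π k := by
    intro k hk
    rw [Equiv.Perm.mul_apply, Fin.cycleRange_of_gt (Fin.lt_def.2 (by omega))]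
  exact ⟨fun H => H.congr fun k hk => h k hk, fun H => H.congr fun k hk => (h k hk).symm⟩

/-- In one-line notation, right multiplication by `Fin.cycleRange i` moves the entry π 0 to position
i and shifts entries 1, …, i left. The tail from j is thus the tail of π from j + 1 with π 0
inserted. -/
theorem tailMono_mul_cycleRange_of_le {m j : ℕ} {π : Equiv.Perm (Fin (m + 1))} {i : Fin (m + 1)}
    (hi : j ≤ (i : ℕ)) :
    TailMono j (π * Fin.cycleRange i) ↔
      TailMono (j + 1) π ∧ ∀ k : Fin (m + 1), j < (k : ℕ) → (k ≤ i ↔ π k < π 0) := by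
  have hlt : ∀ k : Fin (m + 1), 0 < (k : ℕ) → k ≤ i → ∃ l : Fin (m + 1), (l : ℕ) + 1 = k ∧
      (π * Fin.cycleRange i) l = π k := by
    intro k hk hki
    have hk2 := k.2
    rw [Fin.le_def] at hki
    refine ⟨⟨k - 1, by omega⟩, by simp; omega, ?_⟩
    rw [Equiv.Perm.mul_apply]
    congr 1
    ext
    rw [Fin.coe_cycleRange_of_lt (Fin.lt_def.2 (by simp; omega))]
    simp; omega
  have heq : (π * Fin.cycleRange i) i = π 0 := by
    rw [Equiv.Perm.mul_apply, Fin.cycleRange_self]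
  have hgt : ∀ k : Fin (m + 1), i < k → (π * Fin.cycleRange i) k = π k := by
    intro k hk
    rw [Equiv.Perm.mul_apply, Fin.cycleRange_of_gt hk]
  constructor
  · intro h
    have h0 : ∀ k : Fin (m + 1), j < (k : ℕ) → k ≤ i → π k < π 0 := by
      intro k hk hki
      obtain ⟨l, hl, e⟩ := hlt k (by omega) hki
      rw [← e, ← heq]
      rw [Fin.le_def] at hki
      exact h (by simp; omega) hi (Fin.lt_def.2 (by omega))
    have h1 : ∀ k : Fin (m + 1), i < k → π 0 < π k := by
      intro k hki
      rw [← hgt k hki, ← heq]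
      exact h hi (hi.trans hki.le) hki
    refine ⟨fun k hk l hl hkl => ?_, fun k hk => ⟨h0 k hk, fun hk' => ?_⟩⟩
    · simp only [Set.mem_ofPred_eq] at hk hl
      rcases le_or_gt k i with hki | hki
      · rcases le_or_gt l i with hli | hli
        · obtain ⟨k', hk', ek⟩ := hlt k (by omega) hki
          obtain ⟨l', hl', el⟩ := hlt l (by omega) hli
          rw [← ek, ← el]
          rw [Fin.lt_def] at hkl
          exact h (by simp; omega) (by simp; omega) (Fin.lt_def.2 (by omega))
        · exact (h0 k hk hki).trans (h1 l hli)
      · rw [← hgt k hki, ← hgt l (hki.trans hkl)]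
        exact h (by simp; omega) (by simp; omega) hkl
    · by_contra hki
      exact lt_asymm hk' (h1 k (not_le.1 hki))
  · rintro ⟨h, hc⟩
    have hval : ∀ k : Fin (m + 1), k < i → ∃ l : Fin (m + 1), (l : ℕ) = k + 1 ∧ l ≤ i ∧
        (π * Fin.cycleRange i) k = π l := by
      intro k hk
      have hi2 := i.2
      rw [Fin.lt_def] at hk
      refine ⟨⟨k + 1, by omega⟩, rfl, Fin.le_def.2 (by simp; omega), ?_⟩
      obtain ⟨l, hl, e⟩ := hlt ⟨k + 1, by omega⟩ (by simp) (Fin.le_def.2 (by simp; omega))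
      rw [← e]
      congr 1
      ext; simp at hl; omega
    have h1 : ∀ k : Fin (m + 1), i < k → π 0 < π k := by
      intro k hki
      have hj : j < (k : ℕ) := lt_of_le_of_lt hi hki
      refine lt_of_le_of_ne (not_lt.1 fun hk => not_le.2 hki ((hc k hj).2 hk)) fun he => ?_
      have := π.injective he
      rw [← this] at hj
      simp at hj
    intro k hk l hl hkl
    simp only [Set.mem_ofPred_eq] at hk hl
    rcases lt_trichotomy l i with hli | rfl | hli
    · obtain ⟨k', hk', -, ek⟩ := hval k (hkl.trans hli)
      obtain ⟨l', hl', -, el⟩ := hval l hli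
      rw [ek, el]
      rw [Fin.lt_def] at hkl
      exact h (by simp; omega) (by simp; omega) (Fin.lt_def.2 (by omega))
    · obtain ⟨k', hk', hki, ek⟩ := hval k hkl
      rw [ek, heq]
      exact (hc k' (by omega)).1 hki
    · rw [hgt l hli]
      rcases lt_trichotomy k i with hki | rfl | hki
      · obtain ⟨k', hk', hki, ek⟩ := hval k hki
        rw [ek]
        exact ((hc k' (by omega)).1 hki).trans (h1 l hli)
      · rw [heq]; exact h1 l hli
      · rw [hgt k hki]
        have := Fin.lt_def.1 hki
        exact h (by simp; omega) (by simp; omega) hkl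

/-- If `π` is increasing on the levels above `j`, there is exactly one place at or above `j` where
`π 0` has to be inserted to get an increasing sequence from `j` on. -/
theorem existsUnique_tailMono_mul_cycleRange {m j : ℕ} {π : Equiv.Perm (Fin (m + 1))}
    (hj : j < m + 1) (h : TailMono (j + 1) π) :
    ∃! i : Fin (m + 1), j ≤ (i : ℕ) ∧ TailMono j (π * Fin.cycleRange i) := by
  classical
  -- The maximum of `s` is the insertion place; j itself is included for the case where π 0 goes
  -- first.
  let s : Finset (Fin (m + 1)) :=
    Finset.univ.filter fun k => (k : ℕ) = j ∨ j < (k : ℕ) ∧ π k < π 0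
  have hs : s.Nonempty := ⟨⟨j, hj⟩, by simp [s]⟩
  have hm : s.max' hs ∈ s := s.max'_mem hs
  have hjm : j ≤ (s.max' hs : ℕ) := by
    rcases (Finset.mem_filter.1 hm).2 with h1 | h1 <;> omega
  refine ⟨s.max' hs, ⟨hjm, (tailMono_mul_cycleRange_of_le hjm).2 ⟨h, fun k hk => ?_⟩⟩, ?_⟩
  · constructor
    · intro hk'
      rcases (Finset.mem_filter.1 hm).2 with h1 | ⟨h1, h2⟩
      · rw [Fin.le_def] at hk'; omega
      · rcases hk'.eq_or_lt with h3 | h3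
        · rwa [h3]
        · exact (h (by simp; omega) (by simp; omega) h3).trans h2
    · intro hk'
      exact s.le_max' k (by simp [s, hk, hk'])
  · rintro i ⟨hi, hi'⟩
    have hc := ((tailMono_mul_cycleRange_of_le hi).1 hi').2
    apply le_antisymm
    · apply s.le_max'
      simp only [s, Finset.mem_filter, Finset.mem_univ, true_and]
      rcases hi.eq_or_lt with h1 | h1
      · exact Or.inl h1.symm
      · exact Or.inr ⟨h1, (hc i h1).1 le_rfl⟩
    · rcases (Finset.mem_filter.1 hm).2 with h1 | ⟨h1, h2⟩
      · exact Fin.le_def.2 (by omega)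
      · exact (hc _ h1).2 h2

/-! ### Tail sums and their recursion under adding a card. -/

open scoped Classical in
/-- The sum of `F` over the permutations that keep the levels `j, j + 1, …` in order. -/
noncomputable def tailSum {b : ℕ} (j : ℕ) (F : Equiv.Perm (Fin b) → ℤ) : ℤ :=
  ∑ σ, if TailMono j σ then F σ else 0

theorem sum_ite_val_lt {b j : ℕ} (hj : j ≤ b) (a : ℤ) :
    ∑ i : Fin b, (if (i : ℕ) < j then a else 0) = j * a := by
  rw [← Finset.sum_filter, Finset.sum_const, nsmul_eq_mul]
  congr 2
  rw [Fin.card_filter_val_lt, min_eq_right hj]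

/-- Substitute π = σ * `cardPerm i` and fix π. The j cards below j leave the tail alone; of the
others, exactly one restores a tail sorted from j if π is sorted from j + 1, and none otherwise. -/
theorem tailSum_sum_mul_cardPerm {b j : ℕ} (hj : j < b) (F : Equiv.Perm (Fin b) → ℤ) :
    tailSum j (fun σ => ∑ i, F (σ * cardPerm i)) = j * tailSum j F + tailSum (j + 1) F := by
  classical
  obtain ⟨m, rfl⟩ : ∃ m, b = m + 1 := ⟨b - 1, by omega⟩
  have h1 : tailSum j (fun σ => ∑ i, F (σ * cardPerm i)) =
      ∑ π, ∑ i, if TailMono j (π * Fin.cycleRange i) then F π else 0 := by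
    have : ∀ σ : Equiv.Perm (Fin (m + 1)),
        (if TailMono j σ then ∑ i, F (σ * cardPerm i) else 0) =
          ∑ i, if TailMono j σ then F (σ * cardPerm i) else 0 := by
      intro σ
      split_ifs <;> simp
    simp_rw [tailSum, this]
    rw [Finset.sum_comm, Finset.sum_comm (s := Finset.univ (α := Equiv.Perm (Fin (m + 1))))]
    refine Finset.sum_congr rfl fun i _ => ?_
    refine Fintype.sum_equiv (Equiv.mulRight (cardPerm i)) _ _ fun σ => ?_
    have : σ * cardPerm i * Fin.cycleRange i = σ := by
      ext x; simp [cardPerm]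
    simp [this]
  rw [h1, tailSum, tailSum, Finset.mul_sum, ← Finset.sum_add_distrib]
  refine Finset.sum_congr rfl fun π _ => ?_
  rw [← sum_ite_val_lt hj.le]
  have h2 : (if TailMono (j + 1) π then F π else 0) =
      ∑ i : Fin (m + 1), if j ≤ (i : ℕ) ∧ TailMono j (π * Fin.cycleRange i) then F π else 0 := by
    split_ifs with h
    · obtain ⟨i, hi, hu⟩ := existsUnique_tailMono_mul_cycleRange hj h
      rw [Finset.sum_eq_single i (fun k _ hk => if_neg fun hk' => hk (hu k hk')) (by simp),
        if_pos hi]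
    · refine (Finset.sum_eq_zero fun i _ => if_neg fun hi => h ?_).symm
      exact ((tailMono_mul_cycleRange_of_le hi.1).1 hi.2).1
  rw [h2, ← Finset.sum_add_distrib]
  refine Finset.sum_congr rfl fun i _ => ?_
  rcases lt_or_ge (i : ℕ) j with hi | hi
  · rw [tailMono_mul_cycleRange_of_lt hi]
    simp [hi]
  · simp [hi, not_lt.2 hi]

theorem tailSum_eq_sum {b : ℕ} (F : Equiv.Perm (Fin b) → ℤ) : tailSum b F = ∑ σ, F σ :=
  Finset.sum_congr rfl fun σ _ => if_pos (tailMono_of_le (Nat.le_succ b) σ)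

theorem tailSum_zero {b : ℕ} (F : Equiv.Perm (Fin b) → ℤ) : tailSum 0 F = F 1 := by
  simp [tailSum, tailMono_zero_iff]

theorem tailSum_self_sum_mul_cardPerm {b : ℕ} (F : Equiv.Perm (Fin b) → ℤ) :
    tailSum b (fun σ => ∑ i, F (σ * cardPerm i)) = b * tailSum b F := by
  rw [tailSum_eq_sum, tailSum_eq_sum, Finset.sum_comm]
  have : ∀ i : Fin b, ∑ σ, F (σ * cardPerm i) = ∑ σ, F σ := fun i =>
    Equiv.sum_comp (Equiv.mulRight (cardPerm i)) F
  simp [this]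

theorem tailSum_one {b j : ℕ} (hj : j ≤ b) :
    tailSum j (fun _ : Equiv.Perm (Fin b) => 1) = b.descFactorial j := by
  induction j with
  | zero => simp [tailSum_zero]
  | succ j ih =>
    have h := tailSum_sum_mul_cardPerm (Nat.lt_of_succ_le hj) fun _ => 1
    have h' : tailSum j (fun _ : Equiv.Perm (Fin b) => ∑ _i : Fin b, (1 : ℤ)) =
        b * tailSum j fun _ : Equiv.Perm (Fin b) => 1 := by
      simp [tailSum, Finset.mul_sum, -Finset.sum_boole]
    rw [h', ih (Nat.le_of_succ_le hj)] at h
    rw [Nat.descFactorial_succ, Nat.cast_mul, Nat.cast_sub (Nat.le_of_succ_le hj)]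
    linarith

/-! ### Counting single cycles with an increasing tail. -/

open scoped Classical in
/-- The indicator function of the permutations with a single cycle. -/
noncomputable def cyclicIndicator {b : ℕ} (σ : Equiv.Perm (Fin b)) : ℤ :=
  if σ.IsCycleOn Set.univ then 1 else 0

theorem cyclicIndicator_decomposeFin_zero {m : ℕ} (e : Equiv.Perm (Fin (m + 1))) :
    cyclicIndicator (Equiv.Perm.decomposeFin.symm (0, e)) = 0 := by
  rw [cyclicIndicator, if_neg]
  intro h
  have h0 : Equiv.Perm.decomposeFin.symm (0, e) 0 = 0 := by simp
  have := (isCycleOn_univ_iff_sameCycle.1 h 0 1).eq_of_left h0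
  simp at this

theorem sum_perm_fin_eq_sum_insertZero {m : ℕ} (G : Equiv.Perm (Fin (m + 1)) → ℤ)
    (h0 : ∀ e, G (Equiv.Perm.decomposeFin.symm (0, e)) = 0) :
    ∑ σ, G σ = ∑ e : Equiv.Perm (Fin m), ∑ x, G (insertZero e x) := by
  rw [← Equiv.sum_comp Equiv.Perm.decomposeFin.symm, Fintype.sum_prod_type_right]
  refine Finset.sum_congr rfl fun e _ => ?_
  rw [Fin.sum_univ_succ, h0, zero_add]
  exact (Equiv.sum_comp e fun v => G (Equiv.Perm.decomposeFin.symm (v.succ, e))).symm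

open scoped Classical in
theorem tailSum_cyclicIndicator_eq_sum {m : ℕ} (j : ℕ) :
    tailSum (j + 1) (cyclicIndicator (b := m + 2)) =
      ∑ e : Equiv.Perm (Fin (m + 1)), ∑ x,
        if TailMono (j + 1) (insertZero e x) then cyclicIndicator e else 0 := by
  classical
  rw [tailSum, sum_perm_fin_eq_sum_insertZero]
  · refine Finset.sum_congr rfl fun e _ => Finset.sum_congr rfl fun x _ => ?_
    simp only [cyclicIndicator, insertZero_isCycleOn_univ_iff]
  · intro e
    rw [cyclicIndicator_decomposeFin_zero, ite_self]

/-- Delete 0 from its cycle: its predecessor is one of the j points x < j, or x = j; larger x would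
put the value 0 inside the tail. -/
theorem tailSum_cyclicIndicator_succ {m j : ℕ} (hj : j < m + 1) :
    tailSum (j + 1) (cyclicIndicator (b := m + 2)) =
      j * tailSum j (cyclicIndicator (b := m + 1)) +
        tailSum (j + 1) (cyclicIndicator (b := m + 1)) := by
  classical
  rw [tailSum_cyclicIndicator_eq_sum, tailSum, tailSum, Finset.mul_sum, ← Finset.sum_add_distrib]
  refine Finset.sum_congr rfl fun e _ => ?_
  -- Both terms become sums over x, supported on x < j and on x = j.
  rw [← sum_ite_val_lt hj.le, ← Fintype.sum_ite_eq (⟨j, hj⟩ : Fin (m + 1))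
    (fun _ => if TailMono (j + 1) e then cyclicIndicator e else 0), ← Finset.sum_add_distrib]
  refine Finset.sum_congr rfl fun x _ => ?_
  rcases lt_or_ge (x : ℕ) j with hx | hx
  · rw [insertZero_tailMono_of_lt hx, if_neg (c := (⟨j, hj⟩ : Fin (m + 1)) = x)]
    · simp [hx]
    · rintro rfl
      simp at hx
  · simp only [insertZero_tailMono_of_le hx, not_lt.2 hx, if_false, zero_add, Fin.ext_iff,
      ite_and, eq_comm]

theorem tailSum_cyclicIndicator_self {m : ℕ} :
    tailSum (m + 2) (cyclicIndicator (b := m + 2)) =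
      (m + 1 : ℕ) * tailSum (m + 1) (cyclicIndicator (b := m + 1)) := by
  rw [tailSum_cyclicIndicator_eq_sum, tailSum_eq_sum, Finset.mul_sum]
  refine Finset.sum_congr rfl fun e _ => ?_
  simp [tailMono_of_le]

theorem tailSum_cyclicIndicator {b j : ℕ} (hj : j ≤ b) :
    tailSum (j + 1) (cyclicIndicator (b := b + 1)) = b.descFactorial j := by
  induction b generalizing j with
  | zero =>
    obtain rfl : j = 0 := by omega
    rw [tailSum_eq_sum]
    have : ∀ σ : Equiv.Perm (Fin 1), cyclicIndicator σ = 1 := fun σ =>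
      if_pos (isCycleOn_univ_iff_sameCycle.2 fun x y => by
        rw [Subsingleton.elim x y])
    simp [this]
  | succ m ih =>
    rcases hj.eq_or_lt with rfl | hj
    · rw [tailSum_cyclicIndicator_self, ih le_rfl, Nat.succ_descFactorial_succ, Nat.cast_mul]
    · rw [tailSum_cyclicIndicator_succ hj, ih (Nat.le_of_lt_succ hj)]
      cases j with
      | zero => simp
      | succ j =>
        have hjm : j ≤ m := by omega
        rw [ih hjm, Nat.succ_descFactorial_succ, Nat.descFactorial_succ]
        push_cast [Nat.cast_sub hjm]
        ring

theorem tailSum_cyclic_defect {b j : ℕ} (h1 : 1 ≤ j) (hj : j ≤ b) :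
    tailSum j (fun σ : Equiv.Perm (Fin b) => b * cyclicIndicator σ - 1) = 0 := by
  have h : tailSum j (fun σ : Equiv.Perm (Fin b) => b * cyclicIndicator σ - 1) =
      b * tailSum j (cyclicIndicator (b := b)) - tailSum j fun _ : Equiv.Perm (Fin b) => 1 := by
    simp only [tailSum, Finset.mul_sum, ← Finset.sum_sub_distrib]
    refine Finset.sum_congr rfl fun σ _ => ?_
    split_ifs <;> ring
  obtain ⟨j, rfl⟩ : ∃ i, j = i + 1 := ⟨j - 1, by omega⟩
  obtain ⟨b, rfl⟩ : ∃ i, b = i + 1 := ⟨b - 1, by omega⟩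
  rw [h, tailSum_one hj, tailSum_cyclicIndicator (by omega), Nat.succ_descFactorial_succ]
  push_cast
  ring

/-! ### Iterating over the cards and the final count. -/

theorem cardSeqPerm_cons {b n : ℕ} (i : Fin b) (A : Fin n → Fin b) :
    cardSeqPerm (Fin.cons i A : Fin (n + 1) → Fin b) = cardSeqPerm A * cardPerm i := by
  simp [cardSeqPerm, List.ofFn_succ]

theorem sum_cardSeqPerm_succ {b n : ℕ} (F : Equiv.Perm (Fin b) → ℤ) :
    ∑ A : Fin (n + 1) → Fin b, F (cardSeqPerm A) =
      ∑ A : Fin n → Fin b, ∑ i, F (cardSeqPerm A * cardPerm i) := by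
  rw [← Equiv.sum_comp (Fin.consEquiv fun _ => Fin b), Fintype.sum_prod_type_right]
  simp [Fin.consEquiv, cardSeqPerm_cons]

/-- The hypothesis omits j = 0, where the tail sum is F 1; the recursion gives that term coefficient
0, so one card already removes it. -/
theorem sum_cardSeqPerm_eq_zero {b n : ℕ} (hb : 1 ≤ b) {F : Equiv.Perm (Fin b) → ℤ}
    (hF : ∀ j, 1 ≤ j → j ≤ b → tailSum j F = 0) :
    ∑ A : Fin (n + 1) → Fin b, F (cardSeqPerm A) = 0 := by
  induction n generalizing F with
  | zero =>
    have h := tailSum_sum_mul_cardPerm hb F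
    rw [tailSum_zero, hF 1 le_rfl hb] at h
    rw [sum_cardSeqPerm_succ]
    simpa [cardSeqPerm] using h
  | succ n ih =>
    rw [sum_cardSeqPerm_succ]
    refine ih (F := fun σ => ∑ i, F (σ * cardPerm i)) fun j h1 hj => ?_
    rcases hj.eq_or_lt with rfl | hj'
    · rw [tailSum_self_sum_mul_cardPerm, hF _ h1 hj, mul_zero]
    · rw [tailSum_sum_mul_cardPerm hj', hF _ h1 hj, hF _ (by omega) hj', mul_zero, add_zero]

theorem mul_ncard_isCycleOn {b n : ℕ} (hb : 1 ≤ b) (hn : 1 ≤ n) :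
    b * {A : Fin n → Fin b | (cardSeqPerm A).IsCycleOn Set.univ}.ncard = b ^ n := by
  classical
  obtain ⟨n, rfl⟩ : ∃ m, n = m + 1 := ⟨n - 1, by omega⟩
  have h := sum_cardSeqPerm_eq_zero (n := n) hb fun j => tailSum_cyclic_defect (b := b) (j := j)
  rw [Finset.sum_sub_distrib, ← Finset.mul_sum] at h
  simp only [cyclicIndicator, Finset.sum_boole, Finset.sum_const, Finset.card_univ,
    Fintype.card_fun, Fintype.card_fin, nsmul_eq_mul, mul_one] at h
  rw [Set.ncard_eq_toFinset_card']
  simp only [Set.toFinset_ofPred]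
  have h' := sub_eq_zero.1 h
  exact_mod_cast h'

theorem mainTheorem7 (b n : ℕ) (hb : 1 ≤ b) (hn : 1 ≤ n) :
    ProbabilityTheory.uniformOn (Set.univ : Set (Fin n → Fin b))
      {A : Fin n → Fin b | (cardSeqPerm A).IsCycleOn Set.univ} = 1 / (b : ENNReal) := by
  have h := mul_ncard_isCycleOn hb hn
  rw [ProbabilityTheory.uniformOn_univ, MeasureTheory.Measure.count_apply MeasurableSet.of_discrete,
    ← (Set.toFinite _).cast_ncard_eq, Fintype.card_fun, Fintype.card_fin, Fintype.card_fin, ← h]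
  have h0 : {A : Fin n → Fin b | (cardSeqPerm A).IsCycleOn Set.univ}.ncard ≠ 0 := by
    intro h0
    rw [h0, mul_zero] at h
    exact (pow_pos hb n).ne h
  push_cast
  set c := {A : Fin n → Fin b | (cardSeqPerm A).IsCycleOn Set.univ}.ncard
  rw [← ENNReal.mul_div_mul_right 1 (b : ENNReal) (c := c) (by exact_mod_cast h0) (by simp),
    one_mul]
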